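/- Let $(\mathcal X,\mathcal B)$ be a measurable space. For transition (probability) kernels $P_1,P_2$ on it put $$\|P_1-P_2\|:=\sup_{x\in\mathcal X}\ \sup_{|f|\le 1}|P_1f(x)-P_2f(x)|,\qquad Pf(x):=\int f(y)\,P(x,dy),$$ where the inner supremum is over measurable $f:\mathcal X\to\mathbb R$ with $|f(x)|\le 1$ for all $x$; a probability measure $\pi$ is identified with the kernel $x\mapsto\pi$, and $\pi(f):=\int f\,d\pi$. The powers $P^k$ of a kernel are its iterates. **Theorem 3.3.** Let $P,P_0,P_1,\dots$ be transition kernels on $(\mathcal X,\mathcal B)$ such that: (i) for all $x\in\mathcal X$ and $A\in\mathcal B$, $P_n(x,A)\to P(x,A)$ as $n\to\infty$; (ii) $P$ has an invariant probability measure $\pi$, each $P_n$ has an invariant probability measure $\pi_n$, and there is $\rho\in(0,1)$ such that $\|P^k-\pi\|=O(\rho^k)$ and $\|P_n^k-\pi_n\|=O(\rho^k)$ as $k\to\infty$, the latter uniformly in $n$; that is, there is a constant $C<\infty$ with $\|P^k-\pi\|\le C\rho^k$ and $\|P_n^k-\pi_n\|\le C\rho^k$ for all $n,k\ge 0$; (iii)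 for some $\lambda>0$ and some constant $C'<\infty$, $\|P_n-P_{n-1}\|\le C'n^{-\lambda}$ for all $n\ge1$. Let $(X_n)_{n\ge0}$ be an $\mathcal X$-valued Markov chain, defined on some probability space, with initial distribution $\mu$ (an arbitrary probability measure) and transition kernels $(P_n)$: $X_0$ has law $\mu$, and for all $n\ge0$ and $A\in\mathcal B$, $\Pr[X_{n+1}\in A\mid X_0,\dots,X_n]=P_n(X_n,A)$ almost surely. Then for every bounded measurable $f:\mathcal X\to\mathbb R$, as $n\to\infty$, $$\mathbb E[f(X_n)]\longrightarrow\pi(f)\qquad\text{and}\qquad \frac1n\sum_{k=1}^n f(X_k)\longrightarrow\pi(f)\quad\text{almost surely.}$$ -/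

import Mathlib

open MeasureTheory ProbabilityTheory Filter Topology
open scoped ENNReal

/-- The distance `‖P₁ - P₂‖ = sup_x sup_{|f| ≤ 1} |P₁ f(x) - P₂ f(x)|` between two transition
kernels, where `f` ranges over the measurable real functions with `|f| ≤ 1` everywhere. It takes
values in `[0, ∞]`, so that the supremum is a genuine one; a probability measure `π` is viewed
as the constant kernel `Kernel.const 𝒳 π`. -/
noncomputable def kernelDist {𝒳 : Type*} [MeasurableSpace 𝒳] (P₁ P₂ : Kernel 𝒳 𝒳) : ℝ≥0∞ :=
  ⨆ (x : 𝒳) (f : 𝒳 → ℝ) (_ : Measurable f) (_ : ∀ y, |f y| ≤ 1),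
    ENNReal.ofReal |∫ y, f y ∂(P₁ x) - ∫ y, f y ∂(P₂ x)|

/-- `X` is a (non-homogeneous) Markov chain on the probability space `(Ω, Pr)` with initial
distribution `μ` and transition kernels `(P n)`: `X 0` has law `μ`, and for every `n` and every
measurable `A`, the conditional probability of `X (n + 1) ∈ A` given `X 0, …, X n` is
`P n (X n, A)` almost surely. -/
structure IsMarkovChain {Ω 𝒳 : Type*} [MeasurableSpace Ω] [MeasurableSpace 𝒳]
    (Pr : Measure Ω) (μ : Measure 𝒳) (P : ℕ → Kernel 𝒳 𝒳) (X : ℕ → Ω → 𝒳) : Prop where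
  measurable : ∀ n, Measurable (X n)
  initial : Pr.map (X 0) = μ
  transition : ∀ (n : ℕ) (A : Set 𝒳), MeasurableSet A →
    Pr⟦X (n + 1) ⁻¹' A | ⨆ i ∈ Set.Iic n, MeasurableSpace.comap (X i) inferInstance⟧
      =ᵐ[Pr] fun ω => (P n (X n ω)).real A

/-! Only the functions `P_n^k f` enter, with `k` fixed. Uniform ergodicity puts `P_n^k f` within `c
k` of `π_n(f)`, uniformly in `n` and in the starting point, where `c k → 0`. The resulting scheme is
to let `n → ∞` for fixed `k`, and `k → ∞` afterwards. Setwise convergence gives `P_n^k f → P^k f`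
pointwise, hence `π_n(f) → π(f)` (`tendsto_integral_invariant`). As consecutive kernels merge, `k`
steps started at time `n` act asymptotically like `P_n^k`. So `E f(X_{n+k})` is nearly `E[P_n^k
f(X_n)]`, which is within `c k` of `π_n(f)`. For the almost sure limit, let `G_n = ∑_{j<K} P_n^j f`,
so that `G_n - P_n G_n = f - P_n^K f`. This writes `f(X_{n+1}) - π(f)` as an error of size at most
`c K`, plus `π_n(f) - π(f)`, the drift `(G_{n+1} - G_n)(X_{n+1})`, a telescoping bounded term and
the martingale increment `G_n(X_{n+1}) - P_n G_n(X_n)`. The averages of all but the first vanish.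
For the increments this is a strong law for bounded orthogonal variables
(`ae_tendsto_average_zero_of_orthogonal`). -/

/-! ### Strong law for bounded orthogonal variables -/

/-- Second moment bound for sums of bounded, pairwise uncorrelated random variables. -/
theorem integral_sq_sum_le_of_orthogonal {Ω : Type*} [MeasurableSpace Ω] {Pr : Measure Ω}
    [IsProbabilityMeasure Pr] {D : ℕ → Ω → ℝ} {B : ℝ} (hD : ∀ n, Measurable (D n))
    (hB : ∀ n ω, |D n ω| ≤ B) (horth : ∀ i j, i < j → ∫ ω, D i ω * D j ω ∂Pr = 0) (n : ℕ) :
    ∫ ω, (∑ i ∈ Finset.range n, D i ω) ^ 2 ∂Pr ≤ n * B ^ 2 := by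
  have hint : ∀ i j, Integrable (fun ω => D i ω * D j ω) Pr := fun i j =>
    Integrable.of_bound ((hD i).mul (hD j)).aestronglyMeasurable (B * B)
      (ae_of_all _ fun ω => by
        rw [Real.norm_eq_abs, abs_mul]
        exact mul_le_mul (hB i ω) (hB j ω) (abs_nonneg _) ((abs_nonneg _).trans (hB i ω)))
  have hcross : ∀ n, Integrable (fun ω => (∑ i ∈ Finset.range n, D i ω) * D n ω) Pr := fun n => by
    simp only [Finset.sum_mul]
    exact integrable_finsetSum _ fun i _ => hint i n
  have hsq : ∀ n, Integrable (fun ω => (∑ i ∈ Finset.range n, D i ω) ^ 2) Pr := fun n => by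
    simp only [sq, Finset.sum_mul_sum]
    exact integrable_finsetSum _ fun i _ => integrable_finsetSum _ fun j _ => hint i j
  induction n with
  | zero => simp
  | succ n ih =>
    have hcross_zero : ∫ ω, (∑ i ∈ Finset.range n, D i ω) * D n ω ∂Pr = 0 := by
      simp only [Finset.sum_mul]
      rw [integral_finsetSum _ fun i _ => hint i n]
      exact Finset.sum_eq_zero fun i hi => horth i n (Finset.mem_range.1 hi)
    have hlast : ∫ ω, D n ω * D n ω ∂Pr ≤ B ^ 2 := by
      calc ∫ ω, D n ω * D n ω ∂Pr ≤ ∫ _, B ^ 2 ∂Pr :=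
            integral_mono (hint n n) (integrable_const _) fun ω => by
              have := sq_le_sq' (abs_le.1 (hB n ω)).1 (abs_le.1 (hB n ω)).2
              simpa [sq] using this
        _ = B ^ 2 := by simp
    have hexp : ∀ ω, (∑ i ∈ Finset.range (n + 1), D i ω) ^ 2
        = (∑ i ∈ Finset.range n, D i ω) ^ 2
          + (2 * ((∑ i ∈ Finset.range n, D i ω) * D n ω) + D n ω * D n ω) := fun ω => by
      rw [Finset.sum_range_succ]; ring
    simp only [hexp]
    have hrest : Integrable (fun ω => 2 * ((∑ i ∈ Finset.range n, D i ω) * D n ω)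
        + D n ω * D n ω) Pr := ((hcross n).const_mul 2).add (hint n n)
    rw [integral_add (hsq n) hrest,
      integral_add ((hcross n).const_mul 2) (hint n n), integral_const_mul, hcross_zero]
    push_cast
    linarith

/-- Strong law of large numbers for bounded, pairwise uncorrelated, centred random variables. -/
theorem ae_tendsto_average_zero_of_orthogonal {Ω : Type*} [MeasurableSpace Ω] {Pr : Measure Ω}
    [IsProbabilityMeasure Pr] {D : ℕ → Ω → ℝ} {B : ℝ} (hD : ∀ n, Measurable (D n))
    (hB : ∀ n ω, |D n ω| ≤ B) (horth : ∀ i j, i < j → ∫ ω, D i ω * D j ω ∂Pr = 0) :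
    ∀ᵐ ω ∂Pr, Tendsto (fun n : ℕ => (∑ i ∈ Finset.range n, D i ω) / n) atTop (𝓝 0) := by
  set S : ℕ → Ω → ℝ := fun n ω => ∑ i ∈ Finset.range n, D i ω with hS
  have hSm : ∀ n, Measurable (S n) := fun n => Finset.measurable_fun_sum _ fun i _ => hD i
  have hSb : ∀ n ω, |S n ω| ≤ n * B := fun n ω => by
    refine (Finset.abs_sum_le_sum_abs _ _).trans ?_
    refine (Finset.sum_le_sum fun i _ => hB i ω).trans ?_
    simp
  have hSint : ∀ n, Integrable (fun ω => S n ω ^ 2) Pr := fun n =>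
    Integrable.of_bound ((hSm n).pow_const 2).aestronglyMeasurable ((n * B) ^ 2)
      (ae_of_all _ fun ω => by
        rw [Real.norm_eq_abs, abs_pow]
        exact pow_le_pow_left₀ (abs_nonneg _) (hSb n ω) 2)
  -- Along squares the second moment of the average is at most `m² B² / m⁴`, which is summable; at
  -- `m = 0` both sides vanish because division by zero gives zero.
  have hterm : ∀ m : ℕ, ∫⁻ ω, ENNReal.ofReal ((S (m ^ 2) ω / (m ^ 2 : ℕ)) ^ 2) ∂Pr
      ≤ ENNReal.ofReal (B ^ 2 * (1 / (m : ℝ) ^ 2)) := fun m => by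
    have hint : Integrable (fun ω => (S (m ^ 2) ω / (m ^ 2 : ℕ)) ^ 2) Pr := by
      simp only [div_pow]
      exact (hSint _).div_const _
    rw [← ofReal_integral_eq_lintegral_ofReal hint (ae_of_all _ fun ω => sq_nonneg _)]
    apply ENNReal.ofReal_le_ofReal
    simp only [div_pow]
    rw [integral_div]
    rcases Nat.eq_zero_or_pos m with rfl | hm
    · simp
    have hm' : (0 : ℝ) < m := by exact_mod_cast hm
    rw [div_le_iff₀ (by positivity)]
    refine (integral_sq_sum_le_of_orthogonal hD hB horth (m ^ 2)).trans (le_of_eq ?_)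
    push_cast
    field_simp
  have hfin : ∫⁻ ω, ∑' m : ℕ, ENNReal.ofReal ((S (m ^ 2) ω / (m ^ 2 : ℕ)) ^ 2) ∂Pr ≠ ∞ := by
    rw [lintegral_tsum fun m =>
      (((hSm _).div_const _).pow_const 2).ennreal_ofReal.aemeasurable]
    refine ne_top_of_le_ne_top ?_ (ENNReal.tsum_le_tsum hterm)
    exact ((Real.summable_one_div_nat_pow.2 one_lt_two).mul_left (B ^ 2)).tsum_ofReal_ne_top
  have hae := ae_lt_top' (AEMeasurable.tsum fun m =>
    (((hSm _).div_const _).pow_const 2).ennreal_ofReal.aemeasurable) hfin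
  filter_upwards [hae] with ω hω
  have hsq : Tendsto (fun m : ℕ => S (m ^ 2) ω / (m ^ 2 : ℕ)) atTop (𝓝 0) := by
    have h0 := ENNReal.tendsto_atTop_zero_of_tsum_ne_top hω.ne
    have h1 := (ENNReal.tendsto_toReal ENNReal.zero_ne_top).comp h0
    have h2 : Tendsto (fun m : ℕ => (S (m ^ 2) ω / (m ^ 2 : ℕ)) ^ 2) atTop (𝓝 0) := by
      refine h1.congr fun m => ?_
      simp only [Function.comp_apply]
      exact ENNReal.toReal_ofReal (sq_nonneg _)
    have h3 := h2.sqrt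
    simp only [Real.sqrt_sq_eq_abs, Real.sqrt_zero] at h3
    exact (tendsto_zero_iff_abs_tendsto_zero _).2 h3
  -- Adding `B` to each increment makes it nonnegative; monotonicity then fills the gaps between
  -- squares, whose successive ratios tend to 1.
  have hmono : Monotone fun n : ℕ => S n ω + n * B := by
    refine monotone_nat_of_le_succ fun n => ?_
    simp only [hS, Finset.sum_range_succ]
    push_cast
    linarith [(abs_le.1 (hB n ω)).1]
  have hshift : ∀ n : ℕ, n ≠ 0 → (S n ω + n * B) / n = S n ω / n + B := fun n hn => by
    field_simp
  have key : Tendsto (fun n : ℕ => (S n ω + n * B) / n) atTop (𝓝 B) := by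
    refine tendsto_div_of_monotone_of_exists_subseq_tendsto_div _ B hmono fun a ha => ?_
    refine ⟨fun m => m ^ 2, ?_, tendsto_pow_atTop two_ne_zero, ?_⟩
    · have hlim : Tendsto (fun m : ℕ => (1 + 1 / (m : ℝ)) ^ 2) atTop (𝓝 1) := by
        simpa using (tendsto_one_div_atTop_nhds_zero_nat (𝕜 := ℝ)).const_add 1 |>.pow 2
      filter_upwards [hlim.eventually_lt_const ha, eventually_gt_atTop 0] with m hm hm0
      have hm' : (0 : ℝ) < m := by exact_mod_cast hm0
      have : ((m + 1 : ℕ) : ℝ) ^ 2 = (1 + 1 / (m : ℝ)) ^ 2 * (m : ℝ) ^ 2 := by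
        push_cast
        field_simp
      push_cast at this ⊢
      rw [this]
      gcongr
    · have := hsq.add_const B
      rw [zero_add] at this
      refine this.congr' ?_
      filter_upwards [eventually_ne_atTop 0] with m hm
      exact (hshift _ (pow_ne_zero 2 hm)).symm
  have := key.sub_const B
  rw [sub_self] at this
  refine this.congr' ?_
  filter_upwards [eventually_ne_atTop 0] with n hn
  rw [hshift n hn, add_sub_cancel_right]

/-! ### Markov kernels acting on bounded functions -/

/-- The action `f ↦ ∫ f(y) κ(·, dy)` of a kernel on functions. -/
noncomputable def kernelOp {𝒳 : Type*} [MeasurableSpace 𝒳] (κ : Kernel 𝒳 𝒳) (f : 𝒳 → ℝ) : 𝒳 → ℝ :=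
  fun x => ∫ y, f y ∂(κ x)

section KernelOp

variable {𝒳 : Type*} [MeasurableSpace 𝒳]

theorem integrable_of_measurable_of_abs_le {ν : Measure 𝒳} [IsFiniteMeasure ν] {f : 𝒳 → ℝ} {M : ℝ}
    (hf : Measurable f) (hM : ∀ x, |f x| ≤ M) : Integrable f ν :=
  Integrable.of_bound hf.aestronglyMeasurable M (ae_of_all _ hM)

theorem abs_integral_le_of_abs_le {ν : Measure 𝒳} [IsProbabilityMeasure ν] {f : 𝒳 → ℝ} {M : ℝ}
    (hM : ∀ x, |f x| ≤ M) : |∫ x, f x ∂ν| ≤ M := by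
  simpa using norm_integral_le_of_norm_le_const (μ := ν) (f := f) (C := M) (ae_of_all _ hM)

theorem measurable_kernelOp (κ : Kernel 𝒳 𝒳) {f : 𝒳 → ℝ} (hf : Measurable f) :
    Measurable (kernelOp κ f) :=
  (hf.stronglyMeasurable.integral_kernel (κ := κ)).measurable

theorem abs_kernelOp_le (κ : Kernel 𝒳 𝒳) [IsMarkovKernel κ] {f : 𝒳 → ℝ} {M : ℝ}
    (hM : ∀ x, |f x| ≤ M) (x : 𝒳) : |kernelOp κ f x| ≤ M :=
  abs_integral_le_of_abs_le hM

theorem measurable_iterate_kernelOp (κ : Kernel 𝒳 𝒳) {f : 𝒳 → ℝ} (hf : Measurable f) (k : ℕ) :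
    Measurable ((kernelOp κ)^[k] f) := by
  induction k with
  | zero => exact hf
  | succ k ih => rw [Function.iterate_succ_apply']; exact measurable_kernelOp κ ih

theorem abs_iterate_kernelOp_le (κ : Kernel 𝒳 𝒳) [IsMarkovKernel κ] {f : 𝒳 → ℝ} {M : ℝ}
    (hM : ∀ x, |f x| ≤ M) (k : ℕ) : ∀ x, |(kernelOp κ)^[k] f x| ≤ M := by
  induction k with
  | zero => exact hM
  | succ k ih => rw [Function.iterate_succ_apply']; exact abs_kernelOp_le κ ih

theorem isMarkovKernel_pow (κ : Kernel 𝒳 𝒳) [IsMarkovKernel κ] (k : ℕ) :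
    IsMarkovKernel (κ ^ k) := by
  induction k with
  | zero => rw [pow_zero]; exact inferInstanceAs (IsMarkovKernel Kernel.id)
  | succ k ih => rw [pow_succ]; exact inferInstanceAs (IsMarkovKernel ((κ ^ k) ∘ₖ κ))

theorem integral_pow_eq_iterate_kernelOp (κ : Kernel 𝒳 𝒳) [IsMarkovKernel κ] {f : 𝒳 → ℝ} {M : ℝ}
    (hf : Measurable f) (hM : ∀ x, |f x| ≤ M) (k : ℕ) (x : 𝒳) :
    ∫ y, f y ∂((κ ^ k) x) = (kernelOp κ)^[k] f x := by
  induction k generalizing x with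
  | zero =>
    change ∫ y, f y ∂(Kernel.id x) = f x
    rw [Kernel.id_apply, integral_dirac' _ _ hf.stronglyMeasurable]
  | succ k ih =>
    have := isMarkovKernel_pow κ k
    rw [Function.iterate_succ_apply', pow_succ]
    change ∫ y, f y ∂(((κ ^ k) ∘ₖ κ) x) = _
    rw [Kernel.integral_comp (integrable_of_measurable_of_abs_le hf hM)]
    simp only [ih]
    rfl

/-- A bound on `kernelDist` controls the difference of integrals of bounded functions. -/
theorem abs_integral_sub_le_of_kernelDist_le {κ₁ κ₂ : Kernel 𝒳 𝒳} {c : ℝ} (hc : 0 ≤ c)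
    (h : kernelDist κ₁ κ₂ ≤ ENNReal.ofReal c) {f : 𝒳 → ℝ} {M : ℝ} (hf : Measurable f)
    (hM : ∀ x, |f x| ≤ M) (x : 𝒳) :
    |∫ y, f y ∂(κ₁ x) - ∫ y, f y ∂(κ₂ x)| ≤ M * c := by
  have hM0 : 0 ≤ M := (abs_nonneg _).trans (hM x)
  rcases hM0.eq_or_lt with rfl | hMpos
  · have : f = fun _ => 0 := funext fun y => abs_nonpos_iff.1 (hM y)
    simp [this]
  have h1 : ENNReal.ofReal |∫ y, f y / M ∂(κ₁ x) - ∫ y, f y / M ∂(κ₂ x)| ≤ ENNReal.ofReal c := by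
    refine le_trans ?_ h
    exact le_iSup_of_le x <| le_iSup_of_le (fun y => f y / M) <|
      le_iSup_of_le (hf.div_const M) <| le_iSup_of_le (fun y => by
        rw [abs_div, abs_of_pos hMpos]
        exact div_le_one_of_le₀ (hM y) hMpos.le) le_rfl
  rw [ENNReal.ofReal_le_ofReal_iff hc, integral_div, integral_div, ← sub_div, abs_div,
    abs_of_pos hMpos, div_le_iff₀ hMpos] at h1
  linarith

/-- Exchange one factor at a time: `κ₁^(k+1) - κ₂^(k+1) = κ₁ (κ₁^k - κ₂^k) + (κ₁ - κ₂) κ₂^k`. Since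
`κ₁` contracts the sup norm, each exchange costs at most `M * e`. -/
theorem abs_iterate_kernelOp_sub_le {κ₁ κ₂ : Kernel 𝒳 𝒳} [IsMarkovKernel κ₁] [IsMarkovKernel κ₂]
    {e : ℝ} (he : ∀ (f : 𝒳 → ℝ) (M : ℝ), Measurable f → (∀ x, |f x| ≤ M) →
      ∀ x, |kernelOp κ₁ f x - kernelOp κ₂ f x| ≤ M * e)
    {f : 𝒳 → ℝ} {M : ℝ} (hf : Measurable f) (hM : ∀ x, |f x| ≤ M) (k : ℕ) :
    ∀ x, |(kernelOp κ₁)^[k] f x - (kernelOp κ₂)^[k] f x| ≤ k * (M * e) := by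
  induction k with
  | zero => simp
  | succ k ih =>
    intro x
    rw [Function.iterate_succ_apply', Function.iterate_succ_apply']
    have hm₁ := measurable_iterate_kernelOp κ₁ hf k
    have hm₂ := measurable_iterate_kernelOp κ₂ hf k
    have hb₁ := abs_iterate_kernelOp_le κ₁ hM k
    have hb₂ := abs_iterate_kernelOp_le κ₂ hM k
    have h1 : |kernelOp κ₁ ((kernelOp κ₁)^[k] f) x - kernelOp κ₁ ((kernelOp κ₂)^[k] f) x|
        ≤ k * (M * e) := by
      unfold kernelOp at *
      rw [← integral_sub (integrable_of_measurable_of_abs_le hm₁ hb₁)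
        (integrable_of_measurable_of_abs_le hm₂ hb₂)]
      exact abs_integral_le_of_abs_le ih
    have h2 := he _ M hm₂ hb₂ x
    have h3 := abs_sub_le (kernelOp κ₁ ((kernelOp κ₁)^[k] f) x)
      (kernelOp κ₁ ((kernelOp κ₂)^[k] f) x) (kernelOp κ₂ ((kernelOp κ₂)^[k] f) x)
    push_cast
    linarith

/-! ### Integrals under setwise convergence -/

/-- A bounded measurable real function is uniformly close to a simple function. -/
theorem exists_simpleFunc_forall_abs_sub_le {g : 𝒳 → ℝ} {M : ℝ} (hg : Measurable g)
    (hM : ∀ x, |g x| ≤ M) {δ : ℝ} (hδ : 0 < δ) :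
    ∃ s : SimpleFunc 𝒳 ℝ, ∀ x, |g x - s x| ≤ δ := by
  -- Round `g` down to the grid `δℤ`; boundedness leaves finitely many values.
  have hm : Measurable fun x => δ * (⌊g x / δ⌋ : ℝ) :=
    ((measurable_from_top (f := fun k : ℤ => (k : ℝ))).comp
      (hg.div_const δ).floor).const_mul δ
  refine ⟨⟨fun x => δ * (⌊g x / δ⌋ : ℝ), fun y => hm (measurableSet_singleton y), ?_⟩, fun x => ?_⟩
  · refine ((Set.finite_Icc ⌊-M / δ⌋ ⌊M / δ⌋).image fun k : ℤ => δ * (k : ℝ)).subset ?_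
    rintro _ ⟨x, rfl⟩
    refine ⟨⌊g x / δ⌋, ⟨Int.floor_mono ?_, Int.floor_mono ?_⟩, rfl⟩
    · exact div_le_div_of_nonneg_right (abs_le.1 (hM x)).1 hδ.le
    · exact div_le_div_of_nonneg_right (abs_le.1 (hM x)).2 hδ.le
  · change |g x - δ * (⌊g x / δ⌋ : ℝ)| ≤ δ
    have h1 := Int.floor_le (g x / δ)
    have h2 := Int.lt_floor_add_one (g x / δ)
    rw [le_div_iff₀ hδ] at h1
    rw [div_lt_iff₀ hδ] at h2
    rw [abs_le]
    constructor <;> linarith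

/-- Setwise convergence of probability measures implies convergence of the integrals of every
bounded measurable function. -/
theorem tendsto_integral_of_setwise {ν : Measure 𝒳} [IsProbabilityMeasure ν] {νn : ℕ → Measure 𝒳}
    [∀ n, IsProbabilityMeasure (νn n)]
    (h : ∀ A, MeasurableSet A → Tendsto (fun n => νn n A) atTop (𝓝 (ν A)))
    {g : 𝒳 → ℝ} {M : ℝ} (hg : Measurable g) (hM : ∀ x, |g x| ≤ M) :
    Tendsto (fun n => ∫ x, g x ∂(νn n)) atTop (𝓝 (∫ x, g x ∂ν)) := by
  have hsimple : ∀ s : SimpleFunc 𝒳 ℝ,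
      Tendsto (fun n => ∫ x, s x ∂(νn n)) atTop (𝓝 (∫ x, s x ∂ν)) := fun s => by
    have hint : ∀ (m : Measure 𝒳) [IsProbabilityMeasure m],
        ∫ x, s x ∂m = ∑ y ∈ s.range, m.real (s ⁻¹' {y}) • y := fun m _ =>
      (SimpleFunc.integral_eq_integral s (SimpleFunc.integrable_of_isFiniteMeasure s)).symm
    rw [hint ν]
    simp only [hint (νn _)]
    refine tendsto_finsetSum _ fun y _ => Tendsto.smul_const ?_ y
    exact (ENNReal.tendsto_toReal (measure_ne_top ν _)).comp (h _ (s.measurableSet_fiber y))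
  rw [Metric.tendsto_atTop]
  intro ε hε
  obtain ⟨s, hs⟩ := exists_simpleFunc_forall_abs_sub_le hg hM (δ := ε / 4) (by positivity)
  have hclose : ∀ (m : Measure 𝒳) [IsProbabilityMeasure m],
      |∫ x, g x ∂m - ∫ x, s x ∂m| ≤ ε / 4 := fun m _ => by
    rw [← integral_sub (integrable_of_measurable_of_abs_le hg hM)
      (SimpleFunc.integrable_of_isFiniteMeasure s)]
    exact abs_integral_le_of_abs_le hs
  obtain ⟨N, hN⟩ := Metric.tendsto_atTop.1 (hsimple s) (ε / 4) (by positivity)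
  refine ⟨N, fun n hn => ?_⟩
  have h1 := hN n hn
  rw [Real.dist_eq] at h1 ⊢
  have h2 := hclose ν
  have h3 := hclose (νn n)
  rw [abs_lt] at *
  rw [abs_le] at h2 h3
  constructor <;> linarith [h1.1, h1.2, h2.1, h2.2, h3.1, h3.2]

/-- Bounded convergence along a setwise convergent sequence of probability measures. -/
theorem tendsto_integral_of_setwise_of_tendsto {ν : Measure 𝒳} [IsProbabilityMeasure ν]
    {νn : ℕ → Measure 𝒳} [∀ n, IsProbabilityMeasure (νn n)]
    (h : ∀ A, MeasurableSet A → Tendsto (fun n => νn n A) atTop (𝓝 (ν A)))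
    {gn : ℕ → 𝒳 → ℝ} {g : 𝒳 → ℝ} {M : ℝ} (hgn : ∀ n, Measurable (gn n)) (hg : Measurable g)
    (hMn : ∀ n x, |gn n x| ≤ M) (hM : ∀ x, |g x| ≤ M)
    (hlim : ∀ x, Tendsto (fun n => gn n x) atTop (𝓝 (g x))) :
    Tendsto (fun n => ∫ x, gn n x ∂(νn n)) atTop (𝓝 (∫ x, g x ∂ν)) := by
  have hdiff : Tendsto (fun n => ∫ x, |gn n x - g x| ∂(νn n)) atTop (𝓝 0) := by
    have hdm : ∀ n, Measurable fun x => |gn n x - g x| := fun n => ((hgn n).sub hg).abs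
    have hdb : ∀ n x, |gn n x - g x| ≤ 2 * M := fun n x => by
      linarith [abs_sub (gn n x) (g x), hMn n x, hM x]
    -- The tail envelope `H m` dominates `|gn n - g|` for all `n ≥ m` and does not depend on `n`, so
    -- setwise convergence applies to it: `m` is chosen from `ν` alone, and only then is `n` taken
    -- large.
    set H : ℕ → 𝒳 → ℝ := fun m x => ⨆ n, |gn (m + n) x - g x| with hH
    have hbdd : ∀ m x, BddAbove (Set.range fun n => |gn (m + n) x - g x|) := fun m x =>
      ⟨2 * M, by rintro _ ⟨n, rfl⟩; exact hdb _ x⟩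
    have hHm : ∀ m, Measurable (H m) := fun m => Measurable.iSup fun n => hdm (m + n)
    have hH0 : ∀ m x, 0 ≤ H m x := fun m x => Real.iSup_nonneg fun n => abs_nonneg _
    have hHb : ∀ m x, |H m x| ≤ 2 * M := fun m x => by
      rw [abs_of_nonneg (hH0 m x)]
      exact ciSup_le fun n => hdb _ x
    have hHlim : ∀ x, Tendsto (fun m => H m x) atTop (𝓝 0) := fun x => by
      rw [Metric.tendsto_atTop]
      intro ε hε
      obtain ⟨N, hN⟩ := Metric.tendsto_atTop.1 (hlim x) (ε / 2) (by positivity)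
      refine ⟨N, fun m hm => ?_⟩
      rw [Real.dist_0_eq_abs, abs_of_nonneg (hH0 m x)]
      have : H m x ≤ ε / 2 := ciSup_le fun n => (hN (m + n) (by omega)).le
      linarith
    have hHint : Tendsto (fun m => ∫ x, H m x ∂ν) atTop (𝓝 0) := by
      have := tendsto_integral_of_dominated_convergence (μ := ν) (F := H) (f := fun _ => 0)
        (fun _ => 2 * M) (fun m => (hHm m).aestronglyMeasurable) (integrable_const _)
        (fun m => ae_of_all _ (hHb m)) (ae_of_all _ hHlim)
      simpa using this
    rw [Metric.tendsto_atTop]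
    intro ε hε
    obtain ⟨m, hm⟩ := (hHint.eventually_lt_const hε).exists
    obtain ⟨N, hN⟩ := eventually_atTop.1
      ((tendsto_integral_of_setwise h (hHm m) (hHb m)).eventually_lt_const hm)
    refine ⟨max N m, fun n hn => ?_⟩
    rw [Real.dist_0_eq_abs, abs_of_nonneg (integral_nonneg fun x => abs_nonneg _)]
    refine lt_of_le_of_lt ?_ (hN n (le_of_max_le_left hn))
    refine integral_mono (integrable_of_measurable_of_abs_le (hdm n) (M := 2 * M) fun x => by
      rw [abs_abs]; exact hdb n x) (integrable_of_measurable_of_abs_le (hHm m) (hHb m)) fun x => ?_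
    obtain ⟨j, rfl⟩ := Nat.exists_eq_add_of_le (le_of_max_le_right hn)
    exact le_ciSup (hbdd m x) j
  have hzero : Tendsto (fun n => ∫ x, gn n x ∂(νn n) - ∫ x, g x ∂(νn n)) atTop (𝓝 0) := by
    refine squeeze_zero_norm (fun n => ?_) hdiff
    rw [← integral_sub (integrable_of_measurable_of_abs_le (hgn n) (hMn n))
      (integrable_of_measurable_of_abs_le hg hM)]
    exact norm_integral_le_integral_norm _
  simpa using hzero.add (tendsto_integral_of_setwise h hg hM)

theorem tendsto_iterate_kernelOp {P : Kernel 𝒳 𝒳} [IsMarkovKernel P] {Pn : ℕ → Kernel 𝒳 𝒳}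
    [∀ n, IsMarkovKernel (Pn n)]
    (h : ∀ (x : 𝒳) (A : Set 𝒳), MeasurableSet A →
      Tendsto (fun n => Pn n x A) atTop (𝓝 (P x A)))
    {f : 𝒳 → ℝ} {M : ℝ} (hf : Measurable f) (hM : ∀ x, |f x| ≤ M) (k : ℕ) :
    ∀ x, Tendsto (fun n => (kernelOp (Pn n))^[k] f x) atTop (𝓝 ((kernelOp P)^[k] f x)) := by
  induction k with
  | zero => exact fun x => tendsto_const_nhds
  | succ k ih =>
    intro x
    simp only [Function.iterate_succ_apply']
    exact tendsto_integral_of_setwise_of_tendsto (h x)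
      (fun n => measurable_iterate_kernelOp (Pn n) hf k) (measurable_iterate_kernelOp P hf k)
      (fun n => abs_iterate_kernelOp_le (Pn n) hM k) (abs_iterate_kernelOp_le P hM k) ih

end KernelOp

/-! ### Markov property and orthogonality of increments -/

section Chain

/-- The σ-algebra generated by `X 0, …, X n`. -/
@[reducible]
def chainPast {Ω 𝒳 : Type*} [MeasurableSpace 𝒳] (X : ℕ → Ω → 𝒳) (n : ℕ) :
    MeasurableSpace Ω :=
  ⨆ i ∈ Set.Iic n, MeasurableSpace.comap (X i) inferInstance

theorem measurable_chainPast {Ω 𝒳 : Type*} [MeasurableSpace 𝒳] {X : ℕ → Ω → 𝒳}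
    {i n : ℕ} (hi : i ≤ n) : Measurable[chainPast X n] (X i) := by
  rw [measurable_iff_comap_le]
  exact le_iSup₂_of_le (f := fun j (_ : j ∈ Set.Iic n) =>
    MeasurableSpace.comap (X j) inferInstance) i hi le_rfl

variable {Ω 𝒳 : Type*} [MeasurableSpace Ω] [MeasurableSpace 𝒳] {Pr : Measure Ω}
  {μ : Measure 𝒳} {Pn : ℕ → Kernel 𝒳 𝒳} {X : ℕ → Ω → 𝒳}

theorem chainPast_le (hX : ∀ n, Measurable (X n)) (n : ℕ) :
    chainPast X n ≤ (inferInstance : MeasurableSpace Ω) :=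
  iSup₂_le fun i _ => (hX i).comap_le

/-- The Markov property for bounded measurable functions. -/
theorem IsMarkovChain.setIntegral_succ [IsProbabilityMeasure Pr] [∀ n, IsMarkovKernel (Pn n)]
    (hX : IsMarkovChain Pr μ Pn X) (n : ℕ) {g : 𝒳 → ℝ} {M : ℝ} (hg : Measurable g)
    (hM : ∀ x, |g x| ≤ M) {s : Set Ω} (hs : MeasurableSet[chainPast X n] s) :
    ∫ ω in s, g (X (n + 1) ω) ∂Pr = ∫ ω in s, kernelOp (Pn n) g (X n ω) ∂Pr := by
  have hle := chainPast_le hX.measurable n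
  -- The transition hypothesis concerns sets only; as an identity between measures on the state
  -- space it extends to integrals of `g`.
  have hmeas : (Pr.restrict s).map (X (n + 1)) = ((Pr.restrict s).map (X n)).bind (Pn n) := by
    ext A hA
    have hreal : ∫ ω in s, (X (n + 1) ⁻¹' A).indicator (fun _ => (1 : ℝ)) ω ∂Pr
        = ∫ ω in s, (Pn n (X n ω)).real A ∂Pr := by
      rw [← setIntegral_condExp hle
        ((integrable_const (1 : ℝ)).indicator (hX.measurable (n + 1) hA)) hs]
      exact integral_congr_ae (ae_restrict_of_ae (hX.transition n A hA))
    rw [Measure.map_apply (hX.measurable _) hA,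
      Measure.bind_apply hA (Pn n).measurable.aemeasurable,
      lintegral_map ((Pn n).measurable_coe hA) (hX.measurable n)]
    rw [integral_indicator_const _ (hX.measurable (n + 1) hA), smul_eq_mul, mul_one] at hreal
    rw [← ofReal_measureReal, hreal, ofReal_integral_eq_lintegral_ofReal]
    · simp [ofReal_measureReal]
    · refine Integrable.of_bound (C := 1) ?_ (ae_of_all _ fun ω => ?_)
      · exact (((Pn n).measurable_coe hA).ennreal_toReal.comp
          (hX.measurable n)).aestronglyMeasurable
      · rw [Real.norm_eq_abs, abs_of_nonneg measureReal_nonneg]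
        exact measureReal_le_one
    · exact ae_of_all _ fun ω => measureReal_nonneg
  have h1 : ∫ y, g y ∂((Pr.restrict s).map (X (n + 1))) = ∫ ω in s, g (X (n + 1) ω) ∂Pr :=
    integral_map (hX.measurable _).aemeasurable hg.aestronglyMeasurable
  have h2 : ∫ x, kernelOp (Pn n) g x ∂((Pr.restrict s).map (X n))
      = ∫ ω in s, kernelOp (Pn n) g (X n ω) ∂Pr :=
    integral_map (hX.measurable _).aemeasurable
      (measurable_kernelOp _ hg).aestronglyMeasurable
  rw [← h1, ← h2, hmeas, Measure.comp_eq_comp_const_apply,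
    Kernel.integral_comp (integrable_of_measurable_of_abs_le hg hM), Kernel.const_apply]
  rfl

theorem IsMarkovChain.integral_succ [IsProbabilityMeasure Pr] [∀ n, IsMarkovKernel (Pn n)]
    (hX : IsMarkovChain Pr μ Pn X) (n : ℕ) {g : 𝒳 → ℝ} {M : ℝ} (hg : Measurable g)
    (hM : ∀ x, |g x| ≤ M) :
    ∫ ω, g (X (n + 1) ω) ∂Pr = ∫ ω, kernelOp (Pn n) g (X n ω) ∂Pr := by
  simpa using hX.setIntegral_succ n hg hM (MeasurableSet.univ (m := chainPast X n))

/-- The increment `g (X (n + 1)) - P n g (X n)` is orthogonal to bounded functions of the past. -/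
theorem IsMarkovChain.integral_mul_increment [IsProbabilityMeasure Pr]
    [∀ n, IsMarkovKernel (Pn n)]
    (hX : IsMarkovChain Pr μ Pn X) (n : ℕ) {g : 𝒳 → ℝ} {M : ℝ} (hg : Measurable g)
    (hM : ∀ x, |g x| ≤ M) {Z : Ω → ℝ} {B : ℝ} (hZ : Measurable[chainPast X n] Z)
    (hZB : ∀ ω, |Z ω| ≤ B) :
    ∫ ω, Z ω * (g (X (n + 1) ω) - kernelOp (Pn n) g (X n ω)) ∂Pr = 0 := by
  have hle := chainPast_le hX.measurable n
  have hi1 : Integrable (fun ω => g (X (n + 1) ω)) Pr :=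
    integrable_of_measurable_of_abs_le (hg.comp (hX.measurable _)) fun ω => hM _
  have hi2 : Integrable (fun ω => kernelOp (Pn n) g (X n ω)) Pr :=
    integrable_of_measurable_of_abs_le ((measurable_kernelOp _ hg).comp (hX.measurable _))
      fun ω => abs_kernelOp_le _ hM _
  set D : Ω → ℝ := fun ω => g (X (n + 1) ω) - kernelOp (Pn n) g (X n ω) with hD
  have hDi : Integrable D Pr := hi1.sub hi2
  have hD0 : (0 : Ω → ℝ) =ᵐ[Pr] Pr[D | chainPast X n] := by
    refine ae_eq_condExp_of_forall_setIntegral_eq hle hDi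
      (fun s _ _ => integrableOn_zero) (fun s hs _ => ?_) aestronglyMeasurable_zero
    rw [hD, integral_sub hi1.integrableOn hi2.integrableOn, hX.setIntegral_succ n hg hM hs]
    simp
  have hmul := condExp_stronglyMeasurable_mul_of_bound hle hZ.stronglyMeasurable hDi B
    (ae_of_all Pr hZB)
  calc ∫ ω, Z ω * D ω ∂Pr = ∫ ω, (Pr[Z * D | chainPast X n]) ω ∂Pr := (integral_condExp hle).symm
    _ = ∫ ω, (0 : ℝ) ∂Pr := integral_congr_ae (by
        filter_upwards [hmul, hD0] with ω h1 h2
        rw [h1, Pi.mul_apply, ← h2]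
        simp)
    _ = 0 := by simp

end Chain

/-! ### Two-parameter limits -/

theorem tendsto_of_forall_approx {u : ℕ → ℝ} {l : ℝ} {c : ℕ → ℝ} (hc : Tendsto c atTop (𝓝 0))
    (h : ∀ k, ∃ r : ℕ → ℝ, Tendsto r atTop (𝓝 0) ∧ ∀ᶠ n in atTop, |u n - l| ≤ c k + |r n|) :
    Tendsto u atTop (𝓝 l) := by
  rw [Metric.tendsto_nhds]
  intro ε hε
  obtain ⟨k, hk⟩ := (hc.eventually_lt_const (half_pos hε)).exists
  obtain ⟨r, hr, hbound⟩ := h k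
  have hr' : Tendsto (fun n => |r n|) atTop (𝓝 0) := (tendsto_zero_iff_abs_tendsto_zero r).1 hr
  filter_upwards [hbound, hr'.eventually_lt_const (half_pos hε)] with n h1 h2
  rw [Real.dist_eq]
  linarith

theorem tendsto_div_nat_zero_of_abs_le {v : ℕ → ℝ} {B : ℝ} (hv : ∀ n, |v n| ≤ B) :
    Tendsto (fun n : ℕ => v n / n) atTop (𝓝 0) :=
  squeeze_zero_norm (fun n => by
    rw [Real.norm_eq_abs, abs_div, Nat.abs_cast]
    exact div_le_div_of_nonneg_right (hv n) n.cast_nonneg)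
    (tendsto_const_div_atTop_nhds_zero_nat B)

/-! ### Limits of invariant means, and the truncated Poisson equation -/

section

variable {𝒳 : Type*} [MeasurableSpace 𝒳]

/-- A single point `x` suffices: `ln n` is within `c k` of the `k`-th iterate at `x`, uniformly in
`n`, and for fixed `k` this iterate converges as `n → ∞`. -/
theorem tendsto_integral_invariant {P : Kernel 𝒳 𝒳} [IsMarkovKernel P] {Pn : ℕ → Kernel 𝒳 𝒳}
    [∀ n, IsMarkovKernel (Pn n)]
    (hsetwise : ∀ (x : 𝒳) (A : Set 𝒳), MeasurableSet A →
      Tendsto (fun n => Pn n x A) atTop (𝓝 (P x A)))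
    {f : 𝒳 → ℝ} {M : ℝ} (hf : Measurable f) (hM : ∀ x, |f x| ≤ M) {l : ℝ} {ln : ℕ → ℝ} (x : 𝒳)
    {c : ℕ → ℝ} (hc : Tendsto c atTop (𝓝 0))
    (hl : ∀ k, |(kernelOp P)^[k] f x - l| ≤ c k)
    (hln : ∀ n k, |(kernelOp (Pn n))^[k] f x - ln n| ≤ c k) :
    Tendsto ln atTop (𝓝 l) := by
  have hc2 : Tendsto (fun k => c k + c k) atTop (𝓝 0) := by simpa using hc.add hc
  refine tendsto_of_forall_approx hc2 fun k =>
    ⟨fun n => (kernelOp (Pn n))^[k] f x - (kernelOp P)^[k] f x, ?_, Eventually.of_forall fun n => ?_⟩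
  · exact tendsto_sub_nhds_zero_iff.2 (tendsto_iterate_kernelOp hsetwise hf hM k x)
  · have h1 := hl k
    have h2 := hln n k
    have h3 : ln n - l = ((kernelOp P)^[k] f x - l) - ((kernelOp (Pn n))^[k] f x - ln n)
        + ((kernelOp (Pn n))^[k] f x - (kernelOp P)^[k] f x) := by ring
    rw [h3]
    refine (abs_add_le _ _).trans (add_le_add_left ?_ _)
    exact (abs_sub _ _).trans (add_le_add h1 h2)

/-- `e` controls the consecutive differences of the kernels `Pn`, uniformly over bounded
measurable functions. -/
def IsStepBound (Pn : ℕ → Kernel 𝒳 𝒳) (e : ℕ → ℝ) : Prop :=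
  ∀ (n : ℕ) (f : 𝒳 → ℝ) (M : ℝ), Measurable f → (∀ x, |f x| ≤ M) →
    ∀ x, |kernelOp (Pn (n + 1)) f x - kernelOp (Pn n) f x| ≤ M * e n

theorem IsStepBound.abs_sub_le {Pn : ℕ → Kernel 𝒳 𝒳} {e : ℕ → ℝ} (he : IsStepBound Pn e) (n k : ℕ)
    {f : 𝒳 → ℝ} {M : ℝ} (hf : Measurable f) (hM : ∀ x, |f x| ≤ M) (x : 𝒳) :
    |kernelOp (Pn (n + k)) f x - kernelOp (Pn n) f x| ≤ M * ∑ j ∈ Finset.range k, e (n + j) := by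
  induction k with
  | zero => simp
  | succ k ih =>
    rw [Finset.sum_range_succ, mul_add, ← add_assoc]
    have h1 := he (n + k) f M hf hM x
    have h2 := _root_.abs_sub_le (kernelOp (Pn (n + k + 1)) f x) (kernelOp (Pn (n + k)) f x)
      (kernelOp (Pn n) f x)
    linarith

/-- The truncated solution `∑_{j < K} κ^j f` of the Poisson equation. -/
noncomputable def truncatedPoisson (κ : Kernel 𝒳 𝒳) (K : ℕ) (f : 𝒳 → ℝ) : 𝒳 → ℝ :=
  fun x => ∑ j ∈ Finset.range K, (kernelOp κ)^[j] f x

theorem measurable_truncatedPoisson (κ : Kernel 𝒳 𝒳) (K : ℕ) {f : 𝒳 → ℝ} (hf : Measurable f) :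
    Measurable (truncatedPoisson κ K f) :=
  Finset.measurable_fun_sum _ fun j _ => measurable_iterate_kernelOp κ hf j

theorem abs_truncatedPoisson_le (κ : Kernel 𝒳 𝒳) [IsMarkovKernel κ] (K : ℕ) {f : 𝒳 → ℝ} {M : ℝ}
    (hM : ∀ x, |f x| ≤ M) (x : 𝒳) : |truncatedPoisson κ K f x| ≤ K * M := by
  refine (Finset.abs_sum_le_sum_abs _ _).trans
    ((Finset.sum_le_sum fun j _ => abs_iterate_kernelOp_le κ hM j x).trans ?_)
  simp

/-- Applying `κ` shifts the sum by one index, so the difference telescopes; `κ^K f` is the price of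
truncation. -/
theorem truncatedPoisson_sub_kernelOp (κ : Kernel 𝒳 𝒳) [IsMarkovKernel κ] (K : ℕ) {f : 𝒳 → ℝ}
    {M : ℝ} (hf : Measurable f) (hM : ∀ x, |f x| ≤ M) (x : 𝒳) :
    truncatedPoisson κ K f x - kernelOp κ (truncatedPoisson κ K f) x
      = f x - (kernelOp κ)^[K] f x := by
  have h : kernelOp κ (truncatedPoisson κ K f) x
      = ∑ j ∈ Finset.range K, (kernelOp κ)^[j + 1] f x := by
    simp only [Function.iterate_succ_apply']
    exact integral_finsetSum _ fun j _ => integrable_of_measurable_of_abs_le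
      (measurable_iterate_kernelOp κ hf j) (abs_iterate_kernelOp_le κ hM j)
  rw [h, truncatedPoisson, ← Finset.sum_sub_distrib,
    Finset.sum_range_sub' (fun j => (kernelOp κ)^[j] f x)]
  rfl

theorem IsStepBound.abs_truncatedPoisson_sub_le {Pn : ℕ → Kernel 𝒳 𝒳}
    [∀ n, IsMarkovKernel (Pn n)] {e : ℕ → ℝ} (he : IsStepBound Pn e) (n K : ℕ)
    {f : 𝒳 → ℝ} {M : ℝ} (hf : Measurable f) (hM : ∀ x, |f x| ≤ M) (x : 𝒳) :
    |truncatedPoisson (Pn (n + 1)) K f x - truncatedPoisson (Pn n) K f x|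
      ≤ (∑ j ∈ Finset.range K, (j : ℝ)) * (M * e n) := by
  rw [truncatedPoisson, truncatedPoisson, ← Finset.sum_sub_distrib, Finset.sum_mul]
  exact (Finset.abs_sum_le_sum_abs _ _).trans
    (Finset.sum_le_sum fun j _ => abs_iterate_kernelOp_sub_le (he n) hf hM j x)

end

/-! ### Asymptotics along the chain -/

section Chain

variable {Ω 𝒳 : Type*} [MeasurableSpace Ω] [MeasurableSpace 𝒳] {Pr : Measure Ω}
  [IsProbabilityMeasure Pr] {μ : Measure 𝒳} {Pn : ℕ → Kernel 𝒳 𝒳} [∀ n, IsMarkovKernel (Pn n)]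
  {X : ℕ → Ω → 𝒳}

/-- Over a bounded number of steps the chain behaves as if its kernel were frozen. -/
theorem IsMarkovChain.tendsto_integral_sub_iterate (hX : IsMarkovChain Pr μ Pn X) {e : ℕ → ℝ}
    (he : IsStepBound Pn e) (he0 : Tendsto e atTop (𝓝 0)) {M : ℝ} (k : ℕ) :
    ∀ h : ℕ → 𝒳 → ℝ, (∀ n, Measurable (h n)) → (∀ n x, |h n x| ≤ M) →
      Tendsto (fun n => ∫ ω, h n (X (n + k) ω) ∂Pr
        - ∫ ω, (kernelOp (Pn n))^[k] (h n) (X n ω) ∂Pr) atTop (𝓝 0) := by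
  have hint : ∀ (g : 𝒳 → ℝ) (m : ℕ), Measurable g → (∀ x, |g x| ≤ M) →
      Integrable (fun ω => g (X m ω)) Pr := fun g m hg hb =>
    integrable_of_measurable_of_abs_le (hg.comp (hX.measurable m)) fun ω => hb _
  induction k with
  | zero => intro h _ _; simp
  | succ k ih =>
    intro h hm hb
    -- The last step is replaced by the frozen kernel `Pn n`, which makes the test function depend
    -- on `n`; hence the induction runs over sequences `h`.
    have h1 := ih (fun n => kernelOp (Pn n) (h n)) (fun n => measurable_kernelOp _ (hm n))
      (fun n => abs_kernelOp_le _ (hb n))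
    have h2 : Tendsto (fun n => ∫ ω, h n (X (n + (k + 1)) ω) ∂Pr
        - ∫ ω, kernelOp (Pn n) (h n) (X (n + k) ω) ∂Pr) atTop (𝓝 0) := by
      -- The actual last kernel `Pn (n + k)` is `k` step bounds away from `Pn n`.
      have hsum : Tendsto (fun n => M * ∑ j ∈ Finset.range k, e (n + j)) atTop (𝓝 0) := by
        have := (tendsto_finsetSum (Finset.range k) fun j _ =>
          he0.comp (tendsto_add_atTop_nat j)).const_mul M
        simpa using this
      refine squeeze_zero_norm (fun n => ?_) hsum
      rw [← add_assoc, hX.integral_succ (n + k) (hm n) (hb n),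
        ← integral_sub (hint _ _ (measurable_kernelOp _ (hm n)) (abs_kernelOp_le _ (hb n)))
          (hint _ _ (measurable_kernelOp _ (hm n)) (abs_kernelOp_le _ (hb n)))]
      exact abs_integral_le_of_abs_le fun ω => he.abs_sub_le n k (hm n) (hb n) _
    simpa [Function.iterate_succ_apply] using h2.add h1

theorem IsMarkovChain.tendsto_integral (hX : IsMarkovChain Pr μ Pn X) {e : ℕ → ℝ}
    (he : IsStepBound Pn e) (he0 : Tendsto e atTop (𝓝 0)) {f : 𝒳 → ℝ} {M : ℝ} (hf : Measurable f)
    (hM : ∀ x, |f x| ≤ M) {l : ℝ} {ln : ℕ → ℝ} (hlim : Tendsto ln atTop (𝓝 l)) {c : ℕ → ℝ}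
    (hc : Tendsto c atTop (𝓝 0)) (hln : ∀ n k x, |(kernelOp (Pn n))^[k] f x - ln n| ≤ c k) :
    Tendsto (fun n => ∫ ω, f (X n ω) ∂Pr) atTop (𝓝 l) := by
  refine tendsto_of_forall_approx hc fun k => ?_
  have h1 := hX.tendsto_integral_sub_iterate he he0 k (fun _ => f) (fun _ => hf) (fun _ => hM)
  have h2 := h1.add (tendsto_sub_nhds_zero_iff.2 hlim)
  rw [add_zero] at h2
  refine ⟨_, h2.comp (tendsto_sub_atTop_nat k), ?_⟩
  filter_upwards [eventually_ge_atTop k] with m hm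
  obtain ⟨n, rfl⟩ := Nat.exists_eq_add_of_le' hm
  simp only [Function.comp_apply, Nat.add_sub_cancel]
  have h3 : |∫ ω, (kernelOp (Pn n))^[k] f (X n ω) ∂Pr - ln n| ≤ c k := by
    have hi : Integrable (fun ω => (kernelOp (Pn n))^[k] f (X n ω)) Pr :=
      integrable_of_measurable_of_abs_le
        ((measurable_iterate_kernelOp _ hf k).comp (hX.measurable n))
        fun ω => abs_iterate_kernelOp_le _ hM k _
    have : ∫ ω, (kernelOp (Pn n))^[k] f (X n ω) ∂Pr - ln n
        = ∫ ω, ((kernelOp (Pn n))^[k] f (X n ω) - ln n) ∂Pr := by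
      rw [integral_sub hi (integrable_const _)]
      simp
    rw [this]
    exact abs_integral_le_of_abs_le fun ω => hln n k _
  set a := ∫ ω, f (X (n + k) ω) ∂Pr
  set b := ∫ ω, (kernelOp (Pn n))^[k] f (X n ω) ∂Pr
  have h4 : a - l = (b - ln n) + (a - b + (ln n - l)) := by ring
  rw [h4]
  exact (abs_add_le _ _).trans (add_le_add_left h3 _)

/-- Strong law for the martingale increments of bounded functions along the chain. -/
theorem IsMarkovChain.ae_tendsto_average_increment (hX : IsMarkovChain Pr μ Pn X)
    {G : ℕ → 𝒳 → ℝ} {B : ℝ} (hG : ∀ n, Measurable (G n)) (hB : ∀ n x, |G n x| ≤ B) :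
    ∀ᵐ ω ∂Pr, Tendsto (fun n : ℕ => (∑ k ∈ Finset.range n,
      (G k (X (k + 1) ω) - kernelOp (Pn k) (G k) (X k ω))) / n) atTop (𝓝 0) := by
  have hb : ∀ n ω, |G n (X (n + 1) ω) - kernelOp (Pn n) (G n) (X n ω)| ≤ B + B := fun n ω =>
    (abs_sub _ _).trans (add_le_add (hB n _) (abs_kernelOp_le _ (hB n) _))
  refine ae_tendsto_average_zero_of_orthogonal
    (D := fun k ω => G k (X (k + 1) ω) - kernelOp (Pn k) (G k) (X k ω)) (fun n => ?_) hb
    fun i j hij => ?_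
  · exact ((hG n).comp (hX.measurable _)).sub
      ((measurable_kernelOp _ (hG n)).comp (hX.measurable _))
  · refine hX.integral_mul_increment j (hG j) (hB j) ?_ (hb i)
    -- Increment `i` involves `X (i + 1)`, still in the past of time `j` because `i + 1 ≤ j`.
    exact ((hG i).comp (measurable_chainPast (Nat.succ_le_of_lt hij))).sub
      ((measurable_kernelOp _ (hG i)).comp (measurable_chainPast hij.le))

theorem IsMarkovChain.ae_tendsto_average (hX : IsMarkovChain Pr μ Pn X) {e : ℕ → ℝ}
    (he : IsStepBound Pn e) (he0 : Tendsto e atTop (𝓝 0)) {f : 𝒳 → ℝ} {M : ℝ} (hf : Measurable f)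
    (hM : ∀ x, |f x| ≤ M) {l : ℝ} {ln : ℕ → ℝ} (hlim : Tendsto ln atTop (𝓝 l)) {c : ℕ → ℝ}
    (hc : Tendsto c atTop (𝓝 0)) (hln : ∀ n k x, |(kernelOp (Pn n))^[k] f x - ln n| ≤ c k) :
    ∀ᵐ ω ∂Pr, Tendsto (fun n : ℕ => (1 / (n : ℝ)) * ∑ k ∈ Finset.Icc 1 n, f (X k ω))
      atTop (𝓝 l) := by
  -- One null set serves every truncation level `K`, so `K` may be chosen after `ω`.
  have hinc := ae_all_iff.2 fun K : ℕ => hX.ae_tendsto_average_increment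
    (fun n => measurable_truncatedPoisson (Pn n) K hf)
    (fun n => abs_truncatedPoisson_le (Pn n) K hM)
  filter_upwards [hinc] with ω hω
  refine tendsto_of_forall_approx hc fun K => ?_
  set G : ℕ → 𝒳 → ℝ := fun n => truncatedPoisson (Pn n) K f with hG
  set w : ℕ → ℝ := fun k => G (k + 1) (X (k + 1) ω) - G k (X (k + 1) ω) with hw
  set V : ℕ → ℝ := fun n => f (X n ω) - G n (X n ω) with hV
  set D : ℕ → ℝ := fun k => G k (X (k + 1) ω) - kernelOp (Pn k) (G k) (X k ω) with hD
  set R : ℕ → ℝ := fun k => (kernelOp (Pn k))^[K] f (X k ω) - ln k with hR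
  have hw0 : Tendsto w atTop (𝓝 0) := by
    refine squeeze_zero_norm (fun k => he.abs_truncatedPoisson_sub_le k K hf hM _) ?_
    simpa using (he0.const_mul M).const_mul (∑ j ∈ Finset.range K, (j : ℝ))
  have hV0 : Tendsto (fun n : ℕ => (V n - V 0) / n) atTop (𝓝 0) := by
    have hVb : ∀ n, |V n| ≤ M + K * M := fun n =>
      (abs_sub _ _).trans (add_le_add (hM _) (abs_truncatedPoisson_le _ K hM _))
    exact tendsto_div_nat_zero_of_abs_le fun n =>
      (abs_sub _ _).trans (add_le_add (hVb n) (hVb 0))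
  -- Only the average of `R` need not vanish, and it stays below `c K`. The averages of `ln k - l`
  -- and `w` vanish by Cesàro, that of the `V` increments by boundedness, that of `D` by the strong
  -- law.
  have hsum : ∀ n, ∑ k ∈ Finset.Icc 1 n, f (X k ω) - n * l
      = ∑ k ∈ Finset.range n, R k + (∑ k ∈ Finset.range n, (ln k - l)
        + ∑ k ∈ Finset.range n, w k + (V n - V 0) + ∑ k ∈ Finset.range n, D k) := fun n => by
    induction n with
    | zero => simp
    | succ n ih =>
      rw [Finset.sum_Icc_succ_top (by omega)]
      simp only [Finset.sum_range_succ]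
      have hpois : G n (X n ω) - kernelOp (Pn n) (G n) (X n ω)
          = f (X n ω) - (kernelOp (Pn n))^[K] f (X n ω) :=
        truncatedPoisson_sub_kernelOp (Pn n) K hf hM (X n ω)
      have hstep : f (X (n + 1) ω) - l
          = R n + (ln n - l) + w n + (V (n + 1) - V n) + D n := by
        simp only [hR, hw, hV, hD]
        linarith
      push_cast
      linarith
  have hr := (((tendsto_sub_nhds_zero_iff.2 hlim).cesaro.add hw0.cesaro).add hV0).add (hω K)
  simp only [add_zero] at hr
  refine ⟨_, hr, ?_⟩
  filter_upwards [eventually_gt_atTop 0] with n hn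
  have hn' : (0 : ℝ) < n := by exact_mod_cast hn
  have hdecomp : 1 / (n : ℝ) * ∑ k ∈ Finset.Icc 1 n, f (X k ω) - l
      = (∑ k ∈ Finset.range n, R k) / n
        + ((n : ℝ)⁻¹ * ∑ k ∈ Finset.range n, (ln k - l) + (n : ℝ)⁻¹ * ∑ k ∈ Finset.range n, w k
          + (V n - V 0) / n + (∑ k ∈ Finset.range n, D k) / n) := by
    have := hsum n
    field_simp
    linarith
  rw [hdecomp]
  refine (abs_add_le _ _).trans (add_le_add_left ?_ _)
  rw [abs_div, Nat.abs_cast, div_le_iff₀ hn']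
  refine (Finset.abs_sum_le_sum_abs _ _).trans
    ((Finset.sum_le_sum fun k _ => hln k K (X k ω)).trans ?_)
  simp [mul_comm]

end Chain

/-! ### The convergence theorem -/

theorem theorem3p3 {𝒳 : Type*} [MeasurableSpace 𝒳]
    (P : Kernel 𝒳 𝒳) [IsMarkovKernel P] (Pn : ℕ → Kernel 𝒳 𝒳) [∀ n, IsMarkovKernel (Pn n)]
    -- (i) setwise convergence of the kernels
    (hsetwise : ∀ (x : 𝒳) (A : Set 𝒳), MeasurableSet A →
      Tendsto (fun n => Pn n x A) atTop (𝓝 (P x A)))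
    -- (ii) invariant laws, and uniform geometric ergodicity with a common rate and constant
    (π : Measure 𝒳) [IsProbabilityMeasure π]
    (πn : ℕ → Measure 𝒳) [∀ n, IsProbabilityMeasure (πn n)]
    (hπ : P.Invariant π) (hπn : ∀ n, (Pn n).Invariant (πn n))
    (ρ : ℝ) (hρ : ρ ∈ Set.Ioo (0 : ℝ) 1)
    (hgeom : ∃ C : ℝ, ∀ k : ℕ,
      kernelDist (P ^ k) (Kernel.const 𝒳 π) ≤ ENNReal.ofReal (C * ρ ^ k))
    (hgeomn : ∃ C : ℝ, ∀ n k : ℕ,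
      kernelDist (Pn n ^ k) (Kernel.const 𝒳 (πn n)) ≤ ENNReal.ofReal (C * ρ ^ k))
    -- (iii) diminishing change of the kernels at a polynomial rate
    (lam : ℝ) (hlam : 0 < lam)
    (hdim : ∃ C : ℝ, ∀ n : ℕ, 1 ≤ n →
      kernelDist (Pn n) (Pn (n - 1)) ≤ ENNReal.ofReal (C * (n : ℝ) ^ (-lam)))
    -- the Markov chain, on an arbitrary probability space
    {Ω : Type*} [MeasurableSpace Ω] (Pr : Measure Ω) [IsProbabilityMeasure Pr]
    (μ : Measure 𝒳) [IsProbabilityMeasure μ]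
    (X : ℕ → Ω → 𝒳) (hX : IsMarkovChain Pr μ Pn X)
    (f : 𝒳 → ℝ) (hf : Measurable f) (hfb : ∃ M : ℝ, ∀ x, |f x| ≤ M) :
    Tendsto (fun n => ∫ ω, f (X n ω) ∂Pr) atTop (𝓝 (∫ x, f x ∂π)) ∧
    ∀ᵐ ω ∂Pr, Tendsto (fun n : ℕ => (1 / (n : ℝ)) * ∑ k ∈ Finset.Icc 1 n, f (X k ω))
      atTop (𝓝 (∫ x, f x ∂π)) := by
  obtain ⟨M, hM⟩ := hfb
  obtain ⟨C₁, hC₁⟩ := hgeom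
  obtain ⟨C₂, hC₂⟩ := hgeomn
  obtain ⟨C₃, hC₃⟩ := hdim
  obtain ⟨hρ0, hρ1⟩ := hρ
  obtain ⟨x₀⟩ : Nonempty 𝒳 := nonempty_of_isProbabilityMeasure π
  have hM0 : 0 ≤ M := (abs_nonneg _).trans (hM x₀)
  -- A common nonnegative constant, since the given ones carry no sign.
  set C := max (max C₁ C₂) 0
  have hC0 : 0 ≤ C := le_max_right _ _
  have hpow : ∀ k : ℕ, 0 ≤ ρ ^ k := fun k => pow_nonneg hρ0.le k
  have hgeo : ∀ (κ : Kernel 𝒳 𝒳) [IsMarkovKernel κ] (m : Measure 𝒳) (k : ℕ),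
      kernelDist (κ ^ k) (Kernel.const 𝒳 m) ≤ ENNReal.ofReal (C * ρ ^ k) →
      ∀ x, |(kernelOp κ)^[k] f x - ∫ y, f y ∂m| ≤ M * (C * ρ ^ k) := fun κ _ m k h x => by
    rw [← integral_pow_eq_iterate_kernelOp κ hf hM k x]
    simpa using abs_integral_sub_le_of_kernelDist_le (mul_nonneg hC0 (hpow k)) h hf hM x
  have hl := fun k x => hgeo P π k ((hC₁ k).trans (ENNReal.ofReal_le_ofReal
    (mul_le_mul_of_nonneg_right ((le_max_left _ _).trans (le_max_left _ _)) (hpow k)))) x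
  have hln := fun n k x => hgeo (Pn n) (πn n) k ((hC₂ n k).trans (ENNReal.ofReal_le_ofReal
    (mul_le_mul_of_nonneg_right ((le_max_right _ _).trans (le_max_left _ _)) (hpow k)))) x
  have hc : Tendsto (fun k : ℕ => M * (C * ρ ^ k)) atTop (𝓝 0) := by
    simpa using ((tendsto_pow_atTop_nhds_zero_of_lt_one hρ0.le hρ1).const_mul C).const_mul M
  have hlim : Tendsto (fun n => ∫ y, f y ∂(πn n)) atTop (𝓝 (∫ y, f y ∂π)) :=
    tendsto_integral_invariant hsetwise hf hM x₀ hc (fun k => hl k x₀) fun n k => hln n k x₀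
  -- The step from `n` to `n + 1` is governed by the rate at index `n + 1`.
  have he : IsStepBound Pn fun n => max C₃ 0 * ((n + 1 : ℕ) : ℝ) ^ (-lam) := fun n g B hg hB x => by
    have hrpow : (0 : ℝ) ≤ ((n + 1 : ℕ) : ℝ) ^ (-lam) := Real.rpow_nonneg (Nat.cast_nonneg _) _
    exact abs_integral_sub_le_of_kernelDist_le (mul_nonneg (le_max_right _ _) hrpow)
      ((hC₃ (n + 1) (by omega)).trans (ENNReal.ofReal_le_ofReal
        (mul_le_mul_of_nonneg_right (le_max_left _ _) hrpow))) hg hB x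
  have he0 : Tendsto (fun n : ℕ => max C₃ 0 * ((n + 1 : ℕ) : ℝ) ^ (-lam)) atTop (𝓝 0) := by
    simpa using (((tendsto_rpow_neg_atTop hlam).comp tendsto_natCast_atTop_atTop).comp
      (tendsto_add_atTop_nat 1)).const_mul (max C₃ 0)
  exact ⟨hX.tendsto_integral he he0 hf hM hlim hc hln,
    hX.ae_tendsto_average he he0 hf hM hlim hc hln⟩
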